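/- A \emph{prop} is a strict symmetric monoidal category whose objects are the natural numbers, with $n\oplus m=n+m$ and unit $0$; props form a category $\mathbf{PROP}$ whose morphisms are the identity-on-objects strict symmetric monoidal functors. An \emph{abelian prop} is a prop whose underlying category is abelian and whose monoidal product is the biproduct. Let $\mathcal C$ be an abelian prop, and let - $\mathcal C+\mathcal C^{op}$ be the coproduct of $\mathcal C$ and its opposite prop in $\mathbf{PROP}$; - $\mathrm{Span}(\mathcal C)$ (resp. $\mathrm{Cospan}(\mathcal C)$) be the prop whose arrows $n\to m$ are isomorphism classes of spans $n\leftarrow z\to m$ (resp. cospans $n\to z\leftarrow m$) in $\mathcal C$, composed by pullback (resp. pushout); - $\mathrm{Rel}(\mathcal C)$ (resp. $\mathrm{Corel}(\mathcal C)$) be the prop of relations (resp. corelations) for the epi-mono factorisation system: its arrows are the equivalence classes of spans (resp. cospans) for the equivalence relation generated by identifying two spans (resp. cospans) whenever there is an epimorphism (resp. a monomorphism) between their apices commuting with the legs; composition is by pullback (resp. pushout). In all of them the monoidal product is computed componentwise. Let $\mathcal C+\mathcal C^{op}\to\mathrm{Span}(\mathcal C)$ be induced by $f\mapsto(\xleftarrow{\mathrm{id}}\xrightarrow{f})$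 on $\mathcal C$ and $g\mapsto(\xleftarrow{g}\xrightarrow{\mathrm{id}})$ on $\mathcal C^{op}$, and let $\mathcal C+\mathcal C^{op}\to\mathrm{Cospan}(\mathcal C)$ be induced by $f\mapsto(\xrightarrow{f}\xleftarrow{\mathrm{id}})$ and $g\mapsto(\xrightarrow{\mathrm{id}}\xleftarrow{g})$. Let $\Gamma:\mathrm{Cospan}(\mathcal C)\to\mathrm{Corel}(\mathcal C)$ send a cospan to the corelation it represents, and let $\Pi:\mathrm{Span}(\mathcal C)\to\mathrm{Corel}(\mathcal C)$ send a span to the corelation represented by its pushout; these are morphisms of props. Then the square $$\begin{array}{ccc}\mathcal C+\mathcal C^{op}&\to&\mathrm{Span}(\mathcal C)\\ \downarrow&&\downarrow{\scriptstyle\Pi}\\ \mathrm{Cospan}(\mathcal C)&\xrightarrow{\ \Gamma\ }&\mathrm{Corel}(\mathcal C)\end{array}$$ is a pushout in $\mathbf{PROP}$. Moreover there is an isomorphism of props $\mathrm{Corel}(\mathcal C)\cong\mathrm{Rel}(\mathcal C)$ which carries $\Pi$ to the morphism $\mathrm{Span}(\mathcal C)\to\mathrm{Rel}(\mathcal C)$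 sending a span to the relation it represents, and $\Gamma$ to the morphism $\mathrm{Cospan}(\mathcal C)\to\mathrm{Rel}(\mathcal C)$ sending a cospan to the relation represented by its pullback. -/

import Mathlib

open CategoryTheory CategoryTheory.Limits

universe v

/-- A category whose objects are the natural numbers. Composition is in diagrammatic order. -/
structure NatCategory where
  Hom : ℕ → ℕ → Type v
  id : ∀ a, Hom a a
  comp : ∀ {a b c}, Hom a b → Hom b c → Hom a c
  id_comp : ∀ {a b} (f : Hom a b), comp (id a) f = f
  comp_id : ∀ {a b} (f : Hom a b), comp f (id b) = f
  assoc : ∀ {a b c d} (f : Hom a b) (g : Hom b c) (h : Hom c d),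
    comp (comp f g) h = comp f (comp g h)

namespace NatCategory

attribute [simp] id_comp comp_id assoc

/-- The identity morphism, seen as a morphism between two equal objects. -/
def eqHom (P : NatCategory.{v}) {a b : ℕ} (h : a = b) : P.Hom a b := h ▸ P.id a

@[simp] theorem eqHom_rfl (P : NatCategory.{v}) (a : ℕ) (h : a = a) : P.eqHom h = P.id a := rfl

end NatCategory

/-- A prop: a strict symmetric monoidal category whose objects are the natural numbers, with
`n ⊗ m = n + m` and unit object `0`. Strictness means that the associators and the unitors are
identities; `symm a b` is the symmetry `a ⊗ b ⟶ b ⊗ a`. -/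
structure PROP extends NatCategory.{v} where
  tensor : ∀ {a b c d}, Hom a b → Hom c d → Hom (a + c) (b + d)
  symm : ∀ a b, Hom (a + b) (b + a)
  tensor_id : ∀ a b, tensor (id a) (id b) = id (a + b)
  tensor_comp : ∀ {a b c a' b' c'} (f : Hom a b) (g : Hom b c) (f' : Hom a' b') (g' : Hom b' c'),
    tensor (comp f g) (comp f' g') = comp (tensor f f') (tensor g g')
  tensor_unit : ∀ {a b} (f : Hom a b), tensor f (id 0) = f
  unit_tensor : ∀ {a b} (f : Hom a b),
    comp (tensor (id 0) f) (toNatCategory.eqHom (Nat.zero_add b)) =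
      comp (toNatCategory.eqHom (Nat.zero_add a)) f
  tensor_assoc : ∀ {a b c d k l} (f : Hom a b) (g : Hom c d) (h : Hom k l),
    comp (tensor (tensor f g) h) (toNatCategory.eqHom (Nat.add_assoc b d l)) =
      comp (toNatCategory.eqHom (Nat.add_assoc a c k)) (tensor f (tensor g h))
  symm_natural : ∀ {a b c d} (f : Hom a b) (g : Hom c d),
    comp (tensor f g) (symm b d) = comp (symm a c) (tensor g f)
  symm_symm : ∀ a b, comp (symm a b) (symm b a) = id (a + b)
  hexagon : ∀ a b c, symm a (b + c) =
    comp (toNatCategory.eqHom (Nat.add_assoc a b c).symm)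
      (comp (tensor (symm a b) (id c))
        (comp (toNatCategory.eqHom (Nat.add_assoc b a c))
          (comp (tensor (id b) (symm a c))
            (toNatCategory.eqHom (Nat.add_assoc b c a).symm))))

namespace PROP

/-- A morphism of props: an identity-on-objects strict symmetric monoidal functor. -/
@[ext]
structure Morphism (P Q : PROP.{v}) where
  map : ∀ {a b}, P.Hom a b → Q.Hom a b
  map_id : ∀ a, map (P.id a) = Q.id a
  map_comp : ∀ {a b c} (f : P.Hom a b) (g : P.Hom b c), map (P.comp f g) = Q.comp (map f) (map g)
  map_tensor : ∀ {a b c d} (f : P.Hom a b) (g : P.Hom c d),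
    map (P.tensor f g) = Q.tensor (map f) (map g)
  map_symm : ∀ a b, map (P.symm a b) = Q.symm a b

/-- The category of props. -/
instance : Category PROP.{v} where
  Hom P Q := Morphism P Q
  id P := ⟨fun f => f, fun _ => rfl, fun _ _ => rfl, fun _ _ => rfl, fun _ _ => rfl⟩
  comp F G := ⟨fun f => G.map (F.map f), fun a => by rw [F.map_id, G.map_id],
    fun f g => by rw [F.map_comp, G.map_comp], fun f g => by rw [F.map_tensor, G.map_tensor],
    fun a b => by rw [F.map_symm, G.map_symm]⟩

/-- The underlying map on arrows of a morphism of props. -/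
def app {P Q : PROP.{v}} (F : P ⟶ Q) {a b : ℕ} (f : P.Hom a b) : Q.Hom a b := Morphism.map F f

section
variable {P Q R : PROP.{v}}

theorem hom_ext {F G : P ⟶ Q} (h : ∀ {a b} (f : P.Hom a b), app F f = app G f) : F = G :=
  Morphism.ext (by funext a b f; exact h f)

@[simp] theorem app_id (F : P ⟶ Q) (a : ℕ) : app F (P.id a) = Q.id a := Morphism.map_id F a
@[simp] theorem app_comp (F : P ⟶ Q) {a b c : ℕ} (f : P.Hom a b) (g : P.Hom b c) :
    app F (P.comp f g) = Q.comp (app F f) (app F g) := Morphism.map_comp F f g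
@[simp] theorem app_tensor (F : P ⟶ Q) {a b c d : ℕ} (f : P.Hom a b) (g : P.Hom c d) :
    app F (P.tensor f g) = Q.tensor (app F f) (app F g) := Morphism.map_tensor F f g
@[simp] theorem app_symm (F : P ⟶ Q) (a b : ℕ) : app F (P.symm a b) = Q.symm a b :=
  Morphism.map_symm F a b
@[simp] theorem app_eqHom (F : P ⟶ Q) {a b : ℕ} (h : a = b) : app F (P.eqHom h) = Q.eqHom h := by
  subst h; simp
@[simp] theorem comp_app (F : P ⟶ Q) (G : Q ⟶ R) {a b : ℕ} (f : P.Hom a b) :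
    app (F ≫ G) f = app G (app F f) := rfl
@[simp] theorem id_app {a b : ℕ} (f : P.Hom a b) : app (𝟙 P) f = f := rfl

end

theorem eqHom_comp_eqHom (P : PROP.{v}) {a b c : ℕ} (h : a = b) (k : b = c) :
    P.comp (P.eqHom h) (P.eqHom k) = P.eqHom (h.trans k) := by
  subst h; subst k; simp

theorem eqHom_comp_eqHom_assoc (P : PROP.{v}) {a b c d : ℕ} (h : a = b) (k : b = c)
    (f : P.Hom c d) :
    P.comp (P.eqHom h) (P.comp (P.eqHom k) f) = P.comp (P.eqHom (h.trans k)) f := by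
  subst h; subst k; simp

/-- Two morphisms with a left inverse and a right inverse determine each other. -/
theorem inv_unique (P : PROP.{v}) {a b : ℕ} {f : P.Hom a b} {g h : P.Hom b a}
    (hg : P.comp g f = P.id b) (hh : P.comp f h = P.id a) : g = h := by
  rw [← P.comp_id g, ← hh, ← P.assoc, hg, P.id_comp]

theorem eqHom_swap (P : PROP.{v}) {a a' b b' : ℕ} (h : a = a') (k : b = b') {t : P.Hom a b}
    {f : P.Hom a' b'} (e : P.comp t (P.eqHom k) = P.comp (P.eqHom h) f) :
    P.comp (P.eqHom h.symm) t = P.comp f (P.eqHom k.symm) := by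
  subst h; subst k; simpa using e

/-- The opposite of a category with objects the natural numbers. -/
def _root_.NatCategory.op (P : NatCategory.{v}) : NatCategory.{v} where
  Hom a b := P.Hom b a
  id := P.id
  comp f g := P.comp g f
  id_comp := P.comp_id
  comp_id := P.id_comp
  assoc f g h := (P.assoc h g f).symm

theorem _root_.NatCategory.op_eqHom (P : NatCategory.{v}) {a b : ℕ} (h : a = b) :
    P.op.eqHom h = P.eqHom h.symm := by
  subst h; rfl

/-- The opposite prop, with the same tensor product. -/
def op (P : PROP.{v}) : PROP.{v} where
  toNatCategory := P.toNatCategory.op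
  tensor f g := P.tensor f g
  symm a b := P.symm b a
  tensor_id := P.tensor_id
  tensor_comp f g f' g' := P.tensor_comp g f g' f'
  tensor_unit := P.tensor_unit
  unit_tensor {a b} f := by
    rw [NatCategory.op_eqHom, NatCategory.op_eqHom]
    change P.comp (P.eqHom _) (P.tensor (P.id 0) f) = P.comp f (P.eqHom _)
    exact P.eqHom_swap _ _ (P.unit_tensor (a := b) (b := a) f)
  tensor_assoc {a b c d k l} f g h := by
    rw [NatCategory.op_eqHom, NatCategory.op_eqHom]
    change P.comp (P.eqHom _) (P.tensor (P.tensor f g) h) =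
      P.comp (P.tensor f (P.tensor g h)) (P.eqHom _)
    exact P.eqHom_swap _ _ (P.tensor_assoc f g h)
  symm_natural f g := (P.symm_natural g f).symm
  symm_symm a b := P.symm_symm a b
  hexagon a b c := by
    simp only [NatCategory.op_eqHom]
    change P.symm (b + c) a = P.comp (P.comp (P.comp (P.comp (P.eqHom _)
      (P.tensor (P.id b) (P.symm c a))) (P.eqHom _)) (P.tensor (P.symm b a) (P.id c))) (P.eqHom _)
    have hl (x y : ℕ) : P.comp (P.tensor (P.id x) (P.symm a y)) (P.tensor (P.id x) (P.symm y a)) =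
        P.id _ := by
      rw [← P.tensor_comp, P.symm_symm, P.id_comp, P.tensor_id]
    have hr (x y : ℕ) : P.comp (P.tensor (P.symm a x) (P.id y)) (P.tensor (P.symm x a) (P.id y)) =
        P.id _ := by
      rw [← P.tensor_comp, P.symm_symm, P.id_comp, P.tensor_id]
    refine P.inv_unique (f := P.symm a (b + c)) (P.symm_symm _ _) ?_
    rw [P.hexagon]
    simp only [P.assoc, eqHom_comp_eqHom_assoc, NatCategory.eqHom_rfl, P.id_comp]
    rw [← P.assoc (P.tensor (P.id b) (P.symm a c)), hl, P.id_comp, eqHom_comp_eqHom_assoc,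
      NatCategory.eqHom_rfl, P.id_comp, ← P.assoc (P.tensor (P.symm a b) (P.id c)), hr, P.id_comp,
      eqHom_comp_eqHom, NatCategory.eqHom_rfl]

/-- The opposite is an involution, definitionally. -/
theorem op_op (P : PROP.{v}) : P.op.op = P := rfl


/-! ### Coproducts of props -/

section Coproduct

variable (P Q : PROP.{v})

/-- Formal composites and tensor products of arrows of `P` and of `Q`. -/
inductive CoprodTerm : ℕ → ℕ → Type v
  | inl {a b : ℕ} (f : P.Hom a b) : CoprodTerm a b
  | inr {a b : ℕ} (g : Q.Hom a b) : CoprodTerm a b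
  | comp {a b c : ℕ} (s : CoprodTerm a b) (t : CoprodTerm b c) : CoprodTerm a c
  | tensor {a b c d : ℕ} (s : CoprodTerm a b) (t : CoprodTerm c d) : CoprodTerm (a + c) (b + d)

variable {P Q}

/-- The smallest congruence for which the quotient of the formal terms is a prop and the two
inclusions are morphisms of props. -/
inductive CoprodRel : ∀ {a b : ℕ}, CoprodTerm P Q a b → CoprodTerm P Q a b → Prop
  | refl {a b : ℕ} (s : CoprodTerm P Q a b) : CoprodRel s s
  | symm {a b : ℕ} {s t : CoprodTerm P Q a b} : CoprodRel s t → CoprodRel t s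
  | trans {a b : ℕ} {s t u : CoprodTerm P Q a b} : CoprodRel s t → CoprodRel t u → CoprodRel s u
  | comp_congr {a b c : ℕ} {s s' : CoprodTerm P Q a b} {t t' : CoprodTerm P Q b c} :
      CoprodRel s s' → CoprodRel t t' → CoprodRel (.comp s t) (.comp s' t')
  | tensor_congr {a b c d : ℕ} {s s' : CoprodTerm P Q a b} {t t' : CoprodTerm P Q c d} :
      CoprodRel s s' → CoprodRel t t' → CoprodRel (.tensor s t) (.tensor s' t')
  | inl_comp {a b c : ℕ} (f : P.Hom a b) (g : P.Hom b c) :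
      CoprodRel (.inl (P.comp f g)) (.comp (.inl f) (.inl g))
  | inr_comp {a b c : ℕ} (f : Q.Hom a b) (g : Q.Hom b c) :
      CoprodRel (.inr (Q.comp f g)) (.comp (.inr f) (.inr g))
  | inl_tensor {a b c d : ℕ} (f : P.Hom a b) (g : P.Hom c d) :
      CoprodRel (.inl (P.tensor f g)) (.tensor (.inl f) (.inl g))
  | inr_tensor {a b c d : ℕ} (f : Q.Hom a b) (g : Q.Hom c d) :
      CoprodRel (.inr (Q.tensor f g)) (.tensor (.inr f) (.inr g))
  | id_eq (a : ℕ) : CoprodRel (.inl (P.id a)) (.inr (Q.id a))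
  | symm_eq (a b : ℕ) : CoprodRel (.inl (P.symm a b)) (.inr (Q.symm a b))
  | id_comp {a b : ℕ} (s : CoprodTerm P Q a b) : CoprodRel (.comp (.inl (P.id a)) s) s
  | comp_id {a b : ℕ} (s : CoprodTerm P Q a b) : CoprodRel (.comp s (.inl (P.id b))) s
  | assoc {a b c d : ℕ} (s : CoprodTerm P Q a b) (t : CoprodTerm P Q b c)
      (u : CoprodTerm P Q c d) : CoprodRel (.comp (.comp s t) u) (.comp s (.comp t u))
  | tensor_comp {a b c a' b' c' : ℕ} (s : CoprodTerm P Q a b) (t : CoprodTerm P Q b c)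
      (s' : CoprodTerm P Q a' b') (t' : CoprodTerm P Q b' c') :
      CoprodRel (.tensor (.comp s t) (.comp s' t')) (.comp (.tensor s s') (.tensor t t'))
  | tensor_unit {a b : ℕ} (s : CoprodTerm P Q a b) : CoprodRel (.tensor s (.inl (P.id 0))) s
  | unit_tensor {a b : ℕ} (s : CoprodTerm P Q a b) :
      CoprodRel (.comp (.tensor (.inl (P.id 0)) s) (.inl (P.eqHom (Nat.zero_add b))))
        (.comp (.inl (P.eqHom (Nat.zero_add a))) s)
  | tensor_assoc {a b c d k l : ℕ} (s : CoprodTerm P Q a b) (t : CoprodTerm P Q c d)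
      (u : CoprodTerm P Q k l) :
      CoprodRel (.comp (.tensor (.tensor s t) u) (.inl (P.eqHom (Nat.add_assoc b d l))))
        (.comp (.inl (P.eqHom (Nat.add_assoc a c k))) (.tensor s (.tensor t u)))
  | symm_natural {a b c d : ℕ} (s : CoprodTerm P Q a b) (t : CoprodTerm P Q c d) :
      CoprodRel (.comp (.tensor s t) (.inl (P.symm b d))) (.comp (.inl (P.symm a c)) (.tensor t s))

variable (P Q)

/-- Arrows of the coproduct. -/
def CoprodHom (a b : ℕ) : Type v := Quot (CoprodRel (P := P) (Q := Q) (a := a) (b := b))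

/-- The underlying category of the coproduct. -/
def coprodCat : NatCategory.{v} where
  Hom := CoprodHom P Q
  id a := Quot.mk _ (.inl (P.id a))
  comp := Quot.map₂ CoprodTerm.comp (fun _ _ _ h => .comp_congr (.refl _) h)
    (fun _ _ _ h => .comp_congr h (.refl _))
  id_comp := by rintro a b ⟨f⟩; exact Quot.sound (.id_comp f)
  comp_id := by rintro a b ⟨f⟩; exact Quot.sound (.comp_id f)
  assoc := by rintro a b c d ⟨f⟩ ⟨g⟩ ⟨h⟩; exact Quot.sound (.assoc f g h)

theorem coprodCat_eqHom {a b : ℕ} (h : a = b) :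
    (coprodCat P Q).eqHom h = Quot.mk _ (.inl (P.eqHom h)) := by
  subst h; rfl

/-- The prop generated by the arrows of `P` and of `Q`, subject to the equations that hold in `P`,
those that hold in `Q`, and the laws of props. -/
def coprodProp : PROP.{v} where
  toNatCategory := coprodCat P Q
  tensor := Quot.map₂ CoprodTerm.tensor (fun _ _ _ h => .tensor_congr (.refl _) h)
    (fun _ _ _ h => .tensor_congr h (.refl _))
  symm a b := Quot.mk _ (.inl (P.symm a b))
  tensor_id a b := Quot.sound ((CoprodRel.inl_tensor _ _).symm.trans
    (by rw [P.tensor_id]; exact .refl _))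
  tensor_comp := by
    rintro a b c a' b' c' ⟨f⟩ ⟨g⟩ ⟨f'⟩ ⟨g'⟩; exact Quot.sound (.tensor_comp f g f' g')
  tensor_unit := by rintro a b ⟨f⟩; exact Quot.sound (.tensor_unit f)
  unit_tensor := by
    rintro a b ⟨f⟩
    rw [coprodCat_eqHom, coprodCat_eqHom]
    exact Quot.sound (.unit_tensor f)
  tensor_assoc := by
    rintro a b c d k l ⟨f⟩ ⟨g⟩ ⟨h⟩
    rw [coprodCat_eqHom, coprodCat_eqHom]
    exact Quot.sound (.tensor_assoc f g h)
  symm_natural := by rintro a b c d ⟨f⟩ ⟨g⟩; exact Quot.sound (.symm_natural f g)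
  symm_symm a b := Quot.sound ((CoprodRel.inl_comp _ _).symm.trans
    (by rw [P.symm_symm]; exact .refl _))
  hexagon a b c := by
    simp only [coprodCat_eqHom]
    refine Quot.sound ?_
    rw [P.hexagon]
    refine .trans (.inl_comp _ _) (.comp_congr (.refl _) ?_)
    refine .trans (.inl_comp _ _) (.comp_congr (.inl_tensor _ _) ?_)
    refine .trans (.inl_comp _ _) (.comp_congr (.refl _) ?_)
    exact .trans (.inl_comp _ _) (.comp_congr (.inl_tensor _ _) (.refl _))

/-- The first injection into the coproduct. -/
def coprodInl : P ⟶ coprodProp P Q where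
  map f := Quot.mk _ (.inl f)
  map_id _ := rfl
  map_comp f g := Quot.sound (.inl_comp f g)
  map_tensor f g := Quot.sound (.inl_tensor f g)
  map_symm _ _ := rfl

/-- The second injection into the coproduct. -/
def coprodInr : Q ⟶ coprodProp P Q where
  map f := Quot.mk _ (.inr f)
  map_id a := (Quot.sound (.id_eq a)).symm
  map_comp f g := Quot.sound (.inr_comp f g)
  map_tensor f g := Quot.sound (.inr_tensor f g)
  map_symm a b := (Quot.sound (.symm_eq a b)).symm

variable {P Q} {X : PROP.{v}}

/-- Evaluation of formal terms. -/
def coprodEval (F : P ⟶ X) (G : Q ⟶ X) : ∀ {a b : ℕ}, CoprodTerm P Q a b → X.Hom a b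
  | _, _, .inl f => app F f
  | _, _, .inr g => app G g
  | _, _, .comp s t => X.comp (coprodEval F G s) (coprodEval F G t)
  | _, _, .tensor s t => X.tensor (coprodEval F G s) (coprodEval F G t)

theorem coprodEval_rel (F : P ⟶ X) (G : Q ⟶ X) {a b : ℕ} {s t : CoprodTerm P Q a b}
    (h : CoprodRel s t) : coprodEval F G s = coprodEval F G t := by
  induction h with
  | refl => rfl
  | symm _ ih => exact ih.symm
  | trans _ _ ih ih' => exact ih.trans ih'
  | comp_congr _ _ ih ih' => simp only [coprodEval, ih, ih']
  | tensor_congr _ _ ih ih' => simp only [coprodEval, ih, ih']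
  | tensor_comp => simp only [coprodEval, X.tensor_comp]
  | tensor_unit => simp only [coprodEval, app_id, X.tensor_unit]
  | unit_tensor => simp only [coprodEval, app_id, app_eqHom, X.unit_tensor]
  | tensor_assoc => simp only [coprodEval, app_eqHom, X.tensor_assoc]
  | symm_natural => simp only [coprodEval, app_symm, X.symm_natural]
  | _ => simp [coprodEval]

/-- The morphism out of the coproduct induced by two morphisms. -/
def coprodDesc (F : P ⟶ X) (G : Q ⟶ X) : coprodProp P Q ⟶ X where
  map f := Quot.lift (coprodEval F G) (fun _ _ h => coprodEval_rel F G h) f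
  map_id a := app_id F a
  map_comp := by rintro a b c ⟨f⟩ ⟨g⟩; rfl
  map_tensor := by rintro a b c d ⟨f⟩ ⟨g⟩; rfl
  map_symm a b := app_symm F a b

theorem coprod_hom_ext {F G : coprodProp P Q ⟶ X}
    (hl : coprodInl P Q ≫ F = coprodInl P Q ≫ G) (hr : coprodInr P Q ≫ F = coprodInr P Q ≫ G) :
    F = G := by
  refine hom_ext fun {a b} f => ?_
  obtain ⟨s, rfl⟩ := Quot.exists_rep f
  induction s with
  | inl f => exact congrArg (fun H => app H f) hl
  | inr g => exact congrArg (fun H => app H g) hr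
  | comp s t hs ht =>
    exact (app_comp F (Quot.mk _ s) (Quot.mk _ t)).trans
      ((congrArg₂ X.comp hs ht).trans (app_comp G (Quot.mk _ s) (Quot.mk _ t)).symm)
  | tensor s t hs ht =>
    exact (app_tensor F (Quot.mk _ s) (Quot.mk _ t)).trans
      ((congrArg₂ X.tensor hs ht).trans (app_tensor G (Quot.mk _ s) (Quot.mk _ t)).symm)

/-- The category of props has binary coproducts. -/
instance : HasBinaryCoproducts PROP.{v} :=
  @hasBinaryCoproducts_of_hasColimit_pair _ _ fun {P Q} =>
    ⟨⟨⟨BinaryCofan.mk (coprodInl P Q) (coprodInr P Q),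
      BinaryCofan.IsColimit.mk _ (fun F G => coprodDesc F G) (fun _ _ => rfl) (fun _ _ => rfl)
        (fun _ _ _ hl hr => coprod_hom_ext hl hr)⟩⟩⟩

end Coproduct

/-! ### Abelian props -/

/-- The underlying category of a prop, as a category in the sense of Mathlib. -/
def Ob (_ : PROP.{v}) : Type := ℕ

/-- The natural number `n`, seen as an object of a prop. -/
def ob (P : PROP.{v}) (n : ℕ) : P.Ob := n

instance (P : PROP.{v}) : Category.{v} P.Ob where
  Hom := P.Hom
  id := P.id
  comp := P.comp
  id_comp := P.id_comp
  comp_id := P.comp_id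
  assoc := P.assoc

/-- An arrow of a prop, seen as an arrow of its underlying category. -/
def ar (P : PROP.{v}) {a b : ℕ} (f : P.Hom a b) : P.ob a ⟶ P.ob b := f

/-- An abelian prop: the underlying category is abelian and the monoidal product is the
biproduct. -/
class IsAbelian (P : PROP.{v}) : Prop where
  exists_biproduct : ∃ (_ : Abelian P.Ob)
    (φ : ∀ m n : ℕ, P.ob (m + n) ≅ P.ob m ⊞ P.ob n),
    ∀ {a b c d : ℕ} (f : P.Hom a b) (g : P.Hom c d),
      P.ar (P.tensor f g) ≫ (φ b d).hom = (φ a c).hom ≫ biprod.map (P.ar f) (P.ar g)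

/-- The functor comparing the underlying category of the opposite prop with the opposite
category. -/
def opFunctor (P : PROP.{v}) : P.op.Ob ⥤ P.Obᵒᵖ where
  obj n := Opposite.op (P.ob n)
  map f := Quiver.Hom.op (P.ar f)

instance (P : PROP.{v}) : P.opFunctor.Full where
  map_surjective f := ⟨f.unop, rfl⟩
instance (P : PROP.{v}) : P.opFunctor.Faithful where
  map_injective h := Quiver.Hom.op_inj h
instance (P : PROP.{v}) : P.opFunctor.EssSurj where
  mem_essImage n := ⟨n.unop, ⟨Iso.refl _⟩⟩
instance (P : PROP.{v}) : P.opFunctor.IsEquivalence where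

/-- The opposite category of an abelian category is abelian. -/
noncomputable abbrev opAbelian (P : PROP.{v}) [Abelian P.Ob] : Abelian P.op.Ob :=
  letI : Preadditive P.op.Ob := .ofFullyFaithful (.ofFullyFaithful P.opFunctor)
  haveI : HasFiniteProducts P.op.Ob := ⟨fun _ =>
    Adjunction.hasLimitsOfShape_of_equivalence P.opFunctor⟩
  abelianOfEquivalence P.opFunctor

theorem isAbelian_of_product (P : PROP.{v}) [Abelian P.Ob]
    (fst : ∀ m n : ℕ, P.ob (m + n) ⟶ P.ob m) (snd : ∀ m n : ℕ, P.ob (m + n) ⟶ P.ob n)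
    (lift : ∀ (m n : ℕ) (X : P.Ob) (u : X ⟶ P.ob m) (v : X ⟶ P.ob n),
      ∃ w : X ⟶ P.ob (m + n), w ≫ fst m n = u ∧ w ≫ snd m n = v)
    (ext : ∀ (m n : ℕ) (X : P.Ob) (w w' : X ⟶ P.ob (m + n)), w ≫ fst m n = w' ≫ fst m n →
      w ≫ snd m n = w' ≫ snd m n → w = w')
    (hfst : ∀ {a b c d : ℕ} (f : P.Hom a b) (g : P.Hom c d),
      P.ar (P.tensor f g) ≫ fst b d = fst a c ≫ P.ar f)
    (hsnd : ∀ {a b c d : ℕ} (f : P.Hom a b) (g : P.Hom c d),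
      P.ar (P.tensor f g) ≫ snd b d = snd a c ≫ P.ar g) : P.IsAbelian := by
  choose w hw using fun m n => lift m n _ (biprod.fst : P.ob m ⊞ P.ob n ⟶ _) biprod.snd
  refine ⟨inferInstance, fun m n => ⟨biprod.lift (fst m n) (snd m n), w m n, ?_, ?_⟩, ?_⟩
  · apply ext <;> simp [hw]
  · ext <;> simp [hw]
  · intro a b c d f g
    ext <;> simp [hfst, hsnd]

instance (P : PROP.{v}) [h : P.IsAbelian] : P.op.IsAbelian := by
  obtain ⟨_, φ, hφ⟩ := h
  let _ := P.opAbelian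
  have hφ' {a b c d : ℕ} (f : P.Hom a b) (g : P.Hom c d) :
      (φ a c).inv ≫ P.ar (P.tensor f g) = biprod.map (P.ar f) (P.ar g) ≫ (φ b d).inv := by
    rw [Iso.inv_comp_eq, ← Category.assoc, ← hφ, Category.assoc, Iso.hom_inv_id, Category.comp_id]
  have hl {a b c d : ℕ} (f : P.Hom a b) (g : P.Hom c d) :
      (biprod.inl ≫ (φ a c).inv) ≫ P.ar (P.tensor f g) = P.ar f ≫ biprod.inl ≫ (φ b d).inv := by
    rw [Category.assoc, hφ', biprod.inl_map_assoc]
  have hr {a b c d : ℕ} (f : P.Hom a b) (g : P.Hom c d) :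
      (biprod.inr ≫ (φ a c).inv) ≫ P.ar (P.tensor f g) = P.ar g ≫ biprod.inr ≫ (φ b d).inv := by
    rw [Category.assoc, hφ', biprod.inr_map_assoc]
  refine isAbelian_of_product P.op
    (fun m n => (biprod.inl ≫ (φ m n).inv : P.ob m ⟶ P.ob (m + n)))
    (fun m n => (biprod.inr ≫ (φ m n).inv : P.ob n ⟶ P.ob (m + n))) ?_ ?_ ?_ ?_
  · intro m n X u v
    let u' : P.ob m ⟶ P.ob X := u
    let v' : P.ob n ⟶ P.ob X := v
    refine ⟨((φ m n).hom ≫ biprod.desc u' v' : P.ob (m + n) ⟶ P.ob X), ?_, ?_⟩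
    · change (biprod.inl ≫ (φ m n).inv) ≫ (φ m n).hom ≫ biprod.desc u' v' = u'
      simp
    · change (biprod.inr ≫ (φ m n).inv) ≫ (φ m n).hom ≫ biprod.desc u' v' = v'
      simp
  · intro m n X w w' h h'
    let u : P.ob (m + n) ⟶ P.ob X := w
    let u' : P.ob (m + n) ⟶ P.ob X := w'
    change (biprod.inl ≫ (φ m n).inv) ≫ u = (biprod.inl ≫ (φ m n).inv) ≫ u' at h
    change (biprod.inr ≫ (φ m n).inv) ≫ u = (biprod.inr ≫ (φ m n).inv) ≫ u' at h'
    change u = u'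
    rw [← cancel_epi (φ m n).inv]
    ext
    · simpa using h
    · simpa using h'
  · intro a b c d f g
    exact hl (a := b) (b := a) (c := d) (d := c) f g
  · intro a b c d f g
    exact hr (a := b) (b := a) (c := d) (d := c) f g


/-! ### Spans -/

/-- Pullbacks exist in `P`, and the monoidal product preserves them. -/
class HasSpans (P : PROP.{v}) : Prop where
  hasPullbacks : HasPullbacks P.Ob
  tensor_isPullback : ∀ {a b c d a' b' c' d' : ℕ}
    {p : P.Hom a b} {q : P.Hom a c} {f : P.Hom b d} {g : P.Hom c d}
    {p' : P.Hom a' b'} {q' : P.Hom a' c'} {f' : P.Hom b' d'} {g' : P.Hom c' d'},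
    IsPullback (P.ar p) (P.ar q) (P.ar f) (P.ar g) →
    IsPullback (P.ar p') (P.ar q') (P.ar f') (P.ar g') →
    IsPullback (P.ar (P.tensor p p')) (P.ar (P.tensor q q')) (P.ar (P.tensor f f'))
      (P.ar (P.tensor g g'))

attribute [instance] HasSpans.hasPullbacks

/-- A class of arrows containing the isomorphisms, stable under pullback and closed under the
monoidal product. -/
class SpanClass (P : PROP.{v}) (W : MorphismProperty P.Ob) : Prop where
  of_isIso : ∀ {X Y : P.Ob} (f : X ⟶ Y), IsIso f → W f
  isStableUnderBaseChange : W.IsStableUnderBaseChange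
  tensor : ∀ {a b c d : ℕ} (f : P.Hom a b) (g : P.Hom c d), W (P.ar f) → W (P.ar g) →
    W (P.ar (P.tensor f g))

attribute [instance] SpanClass.isStableUnderBaseChange

/-- A span `a ⟵ apex ⟶ b` in a prop. -/
structure RawSpan (P : PROP.{v}) (a b : ℕ) where
  apex : ℕ
  left : P.Hom apex a
  right : P.Hom apex b

theorem isIso_eqHom (P : PROP.{v}) {a b : ℕ} (h : a = b) : IsIso (P.ar (P.eqHom h)) := by
  subst h; exact inferInstanceAs (IsIso (𝟙 (P.ob a)))

theorem isIso_symm (P : PROP.{v}) (a b : ℕ) : IsIso (P.ar (P.symm a b)) :=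
  ⟨P.ar (P.symm b a), P.symm_symm a b, P.symm_symm b a⟩

section SpanMod

variable {P : PROP.{v}}

/-- Two spans are related if there is an arrow in `W` between their apices, compatible with the
legs. -/
def SpanRel (W : MorphismProperty P.Ob) {a b : ℕ} (s t : RawSpan P a b) : Prop :=
  ∃ e : P.Hom s.apex t.apex, W (P.ar e) ∧ P.comp e t.left = s.left ∧ P.comp e t.right = s.right

/-- Spans from `a` to `b`, modulo the equivalence relation generated by `SpanRel W`. -/
def SpanHom (W : MorphismProperty P.Ob) (a b : ℕ) : Type v :=
  Quot (SpanRel W (a := a) (b := b))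

/-- The class of the span `a ⟵ n ⟶ b` with legs `f` and `g`. -/
def SpanHom.mk (W : MorphismProperty P.Ob) {a b n : ℕ} (f : P.Hom n a) (g : P.Hom n b) :
    SpanHom W a b := Quot.mk _ ⟨n, f, g⟩

variable {W : MorphismProperty P.Ob}

theorem SpanHom.ind {a b : ℕ} (s : SpanHom W a b) :
    ∃ (n : ℕ) (f : P.Hom n a) (g : P.Hom n b), s = SpanHom.mk W f g := by
  obtain ⟨⟨n, f, g⟩, rfl⟩ := Quot.exists_rep s
  exact ⟨n, f, g, rfl⟩

theorem SpanHom.eq_of {a b n m : ℕ} (e : P.Hom n m) (he : W (P.ar e)) {f : P.Hom m a}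
    {g : P.Hom m b} {f' : P.Hom n a} {g' : P.Hom n b} (hf : P.comp e f = f')
    (hg : P.comp e g = g') : SpanHom.mk W f' g' = SpanHom.mk W f g :=
  Quot.sound ⟨e, he, hf, hg⟩

/-- The composite of two spans, computed by a pullback. -/
noncomputable def RawSpan.comp [P.HasSpans] {a b c : ℕ} (s : RawSpan P a b) (t : RawSpan P b c) :
    RawSpan P a c where
  apex := (pullback (P.ar s.right) (P.ar t.left) : P.Ob)
  left := P.comp (pullback.fst (P.ar s.right) (P.ar t.left)) s.left
  right := P.comp (pullback.snd (P.ar s.right) (P.ar t.left)) t.right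

theorem RawSpan.mk_comp [P.HasSpans] [P.SpanClass W] {a b c n m k : ℕ} {f : P.Hom n a}
    {g : P.Hom n b} {h : P.Hom m b} {i : P.Hom m c} {p : P.Hom k n} {q : P.Hom k m}
    (sq : IsPullback (P.ar p) (P.ar q) (P.ar g) (P.ar h)) :
    (Quot.mk _ (RawSpan.comp ⟨n, f, g⟩ ⟨m, h, i⟩) : SpanHom W a c) =
      SpanHom.mk W (P.comp p f) (P.comp q i) := by
  symm
  refine Quot.sound ⟨sq.isoPullback.hom, SpanClass.of_isIso _ (Iso.isIso_hom sq.isoPullback), ?_, ?_⟩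
  · exact (P.assoc _ _ _).symm.trans (congrArg (fun t => P.comp t f) sq.isoPullback_hom_fst)
  · exact (P.assoc _ _ _).symm.trans (congrArg (fun t => P.comp t i) sq.isoPullback_hom_snd)

theorem exists_isPullback [P.HasSpans] {a b c : ℕ} (f : P.Hom a c) (g : P.Hom b c) :
    ∃ (n : ℕ) (p : P.Hom n a) (q : P.Hom n b),
      IsPullback (P.ar p) (P.ar q) (P.ar f) (P.ar g) :=
  ⟨_, _, _, IsPullback.of_hasPullback (P.ar f) (P.ar g)⟩

/-- Composition of classes of spans, by pullback. -/
noncomputable def SpanHom.comp [P.HasSpans] [P.SpanClass W] {a b c : ℕ} (s : SpanHom W a b)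
    (t : SpanHom W b c) : SpanHom W a c :=
  Quot.lift₂ (fun s t => (Quot.mk _ (RawSpan.comp s t) : SpanHom W a c))
    (by
      rintro ⟨n, f, g⟩ ⟨m, h, k⟩ ⟨m', h', k'⟩ ⟨e, he, eh, ek⟩
      dsimp only at e he eh ek
      subst eh ek
      obtain ⟨A', p', q', sq'⟩ := exists_isPullback g h'
      obtain ⟨A, p, q, sq⟩ := exists_isPullback q' e
      have sq2 : IsPullback (P.ar (P.comp p p')) (P.ar q) (P.ar g) (P.ar (P.comp e h')) :=
        sq.paste_horiz sq'
      rw [RawSpan.mk_comp sq', RawSpan.mk_comp sq2]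
      refine SpanHom.eq_of p (MorphismProperty.of_isPullback sq.flip he) (P.assoc _ _ _).symm ?_
      rw [← P.assoc, ← P.assoc]
      exact congrArg (fun t => P.comp t k') sq.w)
    (by
      rintro ⟨m, h, k⟩ ⟨m', h', k'⟩ ⟨n, f, g⟩ ⟨e, he, eh, ek⟩
      dsimp only at e he eh ek
      subst eh ek
      obtain ⟨A', p', q', sq'⟩ := exists_isPullback k' f
      obtain ⟨A, p, q, sq⟩ := exists_isPullback p' e
      have sq2 : IsPullback (P.ar q) (P.ar (P.comp p q')) (P.ar (P.comp e k')) (P.ar f) :=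
        sq.flip.paste_vert sq'
      rw [RawSpan.mk_comp sq', RawSpan.mk_comp sq2]
      refine SpanHom.eq_of p (MorphismProperty.of_isPullback sq.flip he) ?_ (P.assoc _ _ _).symm
      rw [← P.assoc, ← P.assoc]
      exact congrArg (fun t => P.comp t h') sq.w)
    s t

theorem SpanHom.mk_comp_mk [P.HasSpans] [P.SpanClass W] {a b c n m k : ℕ} {f : P.Hom n a}
    {g : P.Hom n b} {h : P.Hom m b} {i : P.Hom m c} {p : P.Hom k n} {q : P.Hom k m}
    (sq : IsPullback (P.ar p) (P.ar q) (P.ar g) (P.ar h)) :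
    (SpanHom.mk W f g).comp (SpanHom.mk W h i) = SpanHom.mk W (P.comp p f) (P.comp q i) :=
  RawSpan.mk_comp sq

/-- The monoidal product of classes of spans, componentwise. -/
def SpanHom.tensor [P.SpanClass W] {a b c d : ℕ} (s : SpanHom W a b)
    (t : SpanHom W c d) : SpanHom W (a + c) (b + d) :=
  Quot.lift₂ (fun s t => SpanHom.mk W (P.tensor s.left t.left) (P.tensor s.right t.right))
    (by
      rintro ⟨n, f, g⟩ ⟨m, h, k⟩ ⟨m', h', k'⟩ ⟨e, he, eh, ek⟩
      dsimp only at e he eh ek ⊢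
      subst eh ek
      rw [← P.id_comp f, ← P.id_comp g, P.tensor_comp, P.tensor_comp, P.id_comp, P.id_comp]
      exact SpanHom.eq_of _ (SpanClass.tensor _ _
        (SpanClass.of_isIso _ (inferInstanceAs (IsIso (𝟙 (P.ob n))))) he) rfl rfl)
    (by
      rintro ⟨m, h, k⟩ ⟨m', h', k'⟩ ⟨n, f, g⟩ ⟨e, he, eh, ek⟩
      dsimp only at e he eh ek ⊢
      subst eh ek
      rw [← P.id_comp f, ← P.id_comp g, P.tensor_comp, P.tensor_comp, P.id_comp, P.id_comp]
      exact SpanHom.eq_of _ (SpanClass.tensor _ _ he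
        (SpanClass.of_isIso _ (inferInstanceAs (IsIso (𝟙 (P.ob n)))))) rfl rfl)
    s t

theorem SpanHom.mk_tensor_mk [P.SpanClass W] {a b c d n m : ℕ} (f : P.Hom n a)
    (g : P.Hom n b) (h : P.Hom m c) (i : P.Hom m d) :
    (SpanHom.mk W f g).tensor (SpanHom.mk W h i) = SpanHom.mk W (P.tensor f h) (P.tensor g i) :=
  rfl

theorem isPullback_id_left {a b : ℕ} (f : P.Hom a b) :
    IsPullback (P.ar f) (P.ar (P.id a)) (P.ar (P.id b)) (P.ar f) :=
  IsPullback.id_vert (P.ar f)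

theorem isPullback_id_right {a b : ℕ} (f : P.Hom a b) :
    IsPullback (P.ar (P.id a)) (P.ar f) (P.ar f) (P.ar (P.id b)) :=
  (isPullback_id_left f).flip

theorem SpanHom.mk_id_comp_mk [P.HasSpans] [P.SpanClass W] {a b c m : ℕ} (f : P.Hom m a)
    (g : P.Hom m b) (i : P.Hom b c) :
    (SpanHom.mk W f g).comp (SpanHom.mk W (P.id b) i) = SpanHom.mk W f (P.comp g i) := by
  rw [SpanHom.mk_comp_mk (isPullback_id_right g), P.id_comp]

theorem SpanHom.mk_comp_mk_id [P.HasSpans] [P.SpanClass W] {a b c m : ℕ} (f : P.Hom b a)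
    (g : P.Hom m b) (i : P.Hom m c) :
    (SpanHom.mk W f (P.id b)).comp (SpanHom.mk W g i) = SpanHom.mk W (P.comp g f) i := by
  rw [SpanHom.mk_comp_mk (isPullback_id_left g), P.id_comp]

end SpanMod

section SpanProp

variable (P : PROP.{v}) (W : MorphismProperty P.Ob) [P.HasSpans] [P.SpanClass W]

/-- The category of classes of spans. -/
noncomputable def spanCat : NatCategory.{v} where
  Hom := SpanHom W
  id a := SpanHom.mk W (P.id a) (P.id a)
  comp := SpanHom.comp
  id_comp s := by
    obtain ⟨n, f, g, rfl⟩ := s.ind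
    rw [SpanHom.mk_comp_mk_id, P.comp_id]
  comp_id s := by
    obtain ⟨n, f, g, rfl⟩ := s.ind
    rw [SpanHom.mk_id_comp_mk, P.comp_id]
  assoc s t u := by
    obtain ⟨n, f, g, rfl⟩ := s.ind
    obtain ⟨m, h, i, rfl⟩ := t.ind
    obtain ⟨l, j, k, rfl⟩ := u.ind
    obtain ⟨A, p, q, sq⟩ := exists_isPullback g h
    obtain ⟨B, p', q', sq'⟩ := exists_isPullback i j
    obtain ⟨D, r, t, sq2⟩ := exists_isPullback q p'
    have sq3 : IsPullback (P.ar r) (P.ar (P.comp t q')) (P.ar (P.comp q i)) (P.ar j) :=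
      sq2.paste_vert sq'
    have sq4 : IsPullback (P.ar (P.comp r p)) (P.ar t) (P.ar g) (P.ar (P.comp p' h)) :=
      sq2.paste_horiz sq
    rw [SpanHom.mk_comp_mk sq, SpanHom.mk_comp_mk sq', SpanHom.mk_comp_mk sq3,
      SpanHom.mk_comp_mk sq4, P.assoc, P.assoc]

theorem spanCat_comp {a b c : ℕ} (s : SpanHom W a b) (t : SpanHom W b c) :
    (spanCat P W).comp s t = s.comp t := rfl

theorem spanCat_id (a : ℕ) : (spanCat P W).id a = SpanHom.mk W (P.id a) (P.id a) := rfl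

theorem spanCat_eqHom {a b : ℕ} (h : a = b) :
    (spanCat P W).eqHom h = SpanHom.mk W (P.id a) (P.eqHom h) := by
  subst h; rfl

theorem spanCat_eqHom' {a b : ℕ} (h : a = b) :
    (spanCat P W).eqHom h = SpanHom.mk W (P.eqHom h.symm) (P.id b) := by
  subst h; rfl

theorem SpanHom.mk_symm (a b : ℕ) :
    SpanHom.mk W (P.id (a + b)) (P.symm a b) = SpanHom.mk W (P.symm b a) (P.id (b + a)) := by
  exact (SpanHom.eq_of (P.symm b a) (SpanClass.of_isIso _ (P.isIso_symm b a))
    (P.comp_id _) (P.symm_symm b a)).symm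

theorem SpanHom.mk_tensor_unit {n a b : ℕ} (f : P.Hom n a) (g : P.Hom n b) :
    SpanHom.mk W (P.tensor (P.id 0) f)
        (P.comp (P.tensor (P.id 0) g) (P.eqHom (Nat.zero_add b))) =
      SpanHom.mk W (P.comp f (P.eqHom (Nat.zero_add a).symm)) g := by
  refine SpanHom.eq_of (P.eqHom (Nat.zero_add n)) (SpanClass.of_isIso _ (P.isIso_eqHom _)) ?_
    (P.unit_tensor g).symm
  rw [← P.assoc, ← P.unit_tensor, P.assoc, eqHom_comp_eqHom, NatCategory.eqHom_rfl, P.comp_id]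

theorem SpanHom.mk_tensor_assoc {a b c a' b' c' n m l : ℕ} (f : P.Hom n a) (f' : P.Hom n a')
    (g : P.Hom m b) (g' : P.Hom m b') (h : P.Hom l c) (h' : P.Hom l c') :
    SpanHom.mk W (P.tensor (P.tensor f g) h)
        (P.comp (P.tensor (P.tensor f' g') h') (P.eqHom (Nat.add_assoc a' b' c'))) =
      SpanHom.mk W (P.comp (P.tensor f (P.tensor g h)) (P.eqHom (Nat.add_assoc a b c).symm))
        (P.tensor f' (P.tensor g' h')) := by
  refine SpanHom.eq_of (P.eqHom (Nat.add_assoc n m l)) (SpanClass.of_isIso _ (P.isIso_eqHom _)) ?_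
    (P.tensor_assoc f' g' h').symm
  rw [← P.assoc, ← P.tensor_assoc, P.assoc, eqHom_comp_eqHom, NatCategory.eqHom_rfl, P.comp_id]

theorem SpanHom.mk_symm_natural {a b a' b' n m : ℕ} (f : P.Hom n a) (f' : P.Hom n a')
    (g : P.Hom m b) (g' : P.Hom m b') :
    SpanHom.mk W (P.tensor f g) (P.comp (P.tensor f' g') (P.symm a' b')) =
      SpanHom.mk W (P.comp (P.tensor g f) (P.symm b a)) (P.tensor g' f') := by
  refine SpanHom.eq_of (P.symm n m) (SpanClass.of_isIso _ (P.isIso_symm _ _)) ?_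
    (P.symm_natural f' g').symm
  rw [← P.assoc, ← P.symm_natural, P.assoc, P.symm_symm, P.comp_id]

theorem SpanHom.mk_id_comp_mk_id {a b c : ℕ} (f : P.Hom a b) (g : P.Hom b c) :
    (SpanHom.mk W (P.id a) f).comp (SpanHom.mk W (P.id b) g) =
      SpanHom.mk W (P.id a) (P.comp f g) :=
  SpanHom.mk_id_comp_mk _ _ _

theorem SpanHom.mk_id_tensor_mk_id {a b c d : ℕ} (f : P.Hom a b) (g : P.Hom c d) :
    (SpanHom.mk W (P.id a) f).tensor (SpanHom.mk W (P.id c) g) =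
      SpanHom.mk W (P.id (a + c)) (P.tensor f g) := by
  rw [SpanHom.mk_tensor_mk, P.tensor_id]

/-- The prop whose arrows are spans in `P`, modulo the equivalence relation generated by the
arrows of spans that lie in `W`. Composition is by pullback and the monoidal product is that of
`P`, applied to both legs. -/
noncomputable def spanProp : PROP.{v} where
  toNatCategory := spanCat P W
  tensor := SpanHom.tensor
  symm a b := SpanHom.mk W (P.id (a + b)) (P.symm a b)
  tensor_id a b := SpanHom.mk_id_tensor_mk_id P W (P.id a) (P.id b) |>.trans
    (by rw [P.tensor_id]; rfl)
  tensor_comp s t s' t' := by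
    obtain ⟨n, f, g, rfl⟩ := s.ind
    obtain ⟨m, h, i, rfl⟩ := t.ind
    obtain ⟨n', f', g', rfl⟩ := s'.ind
    obtain ⟨m', h', i', rfl⟩ := t'.ind
    obtain ⟨A, p, q, sq⟩ := exists_isPullback g h
    obtain ⟨A', p', q', sq'⟩ := exists_isPullback g' h'
    rw [spanCat_comp, spanCat_comp, spanCat_comp, SpanHom.mk_comp_mk sq, SpanHom.mk_comp_mk sq', SpanHom.mk_tensor_mk, SpanHom.mk_tensor_mk,
      SpanHom.mk_tensor_mk, SpanHom.mk_comp_mk (HasSpans.tensor_isPullback sq sq'),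
      P.tensor_comp, P.tensor_comp]
  tensor_unit s := by
    obtain ⟨n, f, g, rfl⟩ := s.ind
    rw [spanCat_id, SpanHom.mk_tensor_mk, P.tensor_unit, P.tensor_unit]
  unit_tensor {a b} s := by
    obtain ⟨n, f, g, rfl⟩ := s.ind
    rw [spanCat_eqHom, spanCat_eqHom', spanCat_comp, spanCat_comp, spanCat_id, SpanHom.mk_tensor_mk, SpanHom.mk_id_comp_mk, SpanHom.mk_comp_mk_id]
    exact SpanHom.mk_tensor_unit P W f g
  tensor_assoc s t u := by
    obtain ⟨n, f, g, rfl⟩ := s.ind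
    obtain ⟨m, h, i, rfl⟩ := t.ind
    obtain ⟨l, j, k, rfl⟩ := u.ind
    rw [spanCat_eqHom, spanCat_eqHom', spanCat_comp, spanCat_comp, SpanHom.mk_tensor_mk, SpanHom.mk_tensor_mk, SpanHom.mk_tensor_mk, SpanHom.mk_tensor_mk,
      SpanHom.mk_id_comp_mk, SpanHom.mk_comp_mk_id]
    exact SpanHom.mk_tensor_assoc P W f g h i j k
  symm_natural s t := by
    obtain ⟨n, f, g, rfl⟩ := s.ind
    obtain ⟨m, h, i, rfl⟩ := t.ind
    rw [spanCat_comp, spanCat_comp, SpanHom.mk_tensor_mk, SpanHom.mk_tensor_mk, SpanHom.mk_id_comp_mk,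
      SpanHom.mk_symm, SpanHom.mk_comp_mk_id]
    exact SpanHom.mk_symm_natural P W f g h i
  symm_symm a b := (SpanHom.mk_id_comp_mk_id P W _ _).trans (by rw [P.symm_symm]; rfl)
  hexagon a b c := by
    simp only [spanCat_eqHom, spanCat_comp, spanCat_id, SpanHom.mk_id_comp_mk_id, SpanHom.mk_id_tensor_mk_id]
    rw [P.hexagon]

/-- The morphism of props sending `f` to the span `a ⟵ a ⟶ b` with legs the identity and `f`. -/
noncomputable def spanOfHom : P ⟶ spanProp P W where
  map f := SpanHom.mk W (P.id _) f
  map_id _ := rfl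
  map_comp f g := (SpanHom.mk_id_comp_mk_id P W f g).symm
  map_tensor f g := (SpanHom.mk_id_tensor_mk_id P W f g).symm
  map_symm _ _ := rfl

/-- The morphism of props sending `g`, seen as an arrow `a ⟶ b` of the opposite prop, to the span
`a ⟵ b ⟶ b` with legs `g` and the identity. -/
noncomputable def spanOfOp : P.op ⟶ spanProp P W where
  map g := SpanHom.mk W g (P.id _)
  map_id _ := rfl
  map_comp {a b c} f g := (SpanHom.mk_comp_mk_id (P := P) (W := W) (a := a) (b := b) (m := c)
    f g (P.id c)).symm
  map_tensor {a b c d} f g := by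
    refine Eq.trans ?_ (SpanHom.mk_tensor_mk (W := W) f (P.id b) g (P.id d)).symm
    rw [P.tensor_id]
    rfl
  map_symm a b := (SpanHom.mk_symm P W a b).symm

theorem app_spanOfHom {a b : ℕ} (f : P.Hom a b) :
    app (spanOfHom P W) f = SpanHom.mk W (P.id a) f := rfl

theorem app_spanOfOp {a b : ℕ} (f : P.Hom b a) :
    app (spanOfOp P W) (a := a) (b := b) f = SpanHom.mk W f (P.id b) := rfl

/-- Every span is the composite of a backward arrow and a forward arrow. -/
theorem spanOfOp_comp_spanOfHom {a b n : ℕ} (f : P.Hom n a) (g : P.Hom n b) :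
    (spanProp P W).comp (app (spanOfOp P W) (a := a) (b := n) f) (app (spanOfHom P W) g) =
      SpanHom.mk W f g := by
  rw [app_spanOfOp, app_spanOfHom]
  exact (SpanHom.mk_comp_mk_id (W := W) f (P.id n) g).trans (by rw [P.id_comp])

theorem spanOfHom_comp_spanOfOp {a b c n : ℕ} {p : P.Hom n a} {q : P.Hom n b} {f : P.Hom a c}
    {g : P.Hom b c} (sq : IsPullback (P.ar p) (P.ar q) (P.ar f) (P.ar g)) :
    (spanProp P W).comp (app (spanOfHom P W) f) (app (spanOfOp P W) (a := c) (b := b) g) =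
      SpanHom.mk W p q := by
  rw [app_spanOfOp, app_spanOfHom]
  exact (SpanHom.mk_comp_mk (W := W) sq).trans (by rw [P.comp_id, P.comp_id])

end SpanProp


/-! ### Spans, cospans, relations and corelations in an abelian prop -/

section Abelian

theorem isPullback_biprod_map {A : Type*} [Category A] [Abelian A]
    {a b c d a' b' c' d' : A} {p : a ⟶ b} {q : a ⟶ c} {f : b ⟶ d} {g : c ⟶ d}
    {p' : a' ⟶ b'} {q' : a' ⟶ c'} {f' : b' ⟶ d'} {g' : c' ⟶ d'}
    (sq : IsPullback p q f g) (sq' : IsPullback p' q' f' g') :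
    IsPullback (biprod.map p p') (biprod.map q q') (biprod.map f f') (biprod.map g g') := by
  refine ⟨⟨by ext <;> simp [sq.w, sq'.w]⟩, ⟨PullbackCone.IsLimit.mk _ (fun s =>
    biprod.lift
      (sq.lift (s.fst ≫ biprod.fst) (s.snd ≫ biprod.fst)
        (by simpa using congrArg (fun t => t ≫ biprod.fst) s.condition))
      (sq'.lift (s.fst ≫ biprod.snd) (s.snd ≫ biprod.snd)
        (by simpa using congrArg (fun t => t ≫ biprod.snd) s.condition))) ?_ ?_ ?_⟩⟩
  · intro s; ext <;> simp
  · intro s; ext <;> simp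
  · intro s m h h'
    ext
    · apply sq.hom_ext <;> simp [← h, ← h']
    · apply sq'.hom_ext <;> simp [← h, ← h']

/-- In an abelian category, the canonical arrow from the pushout of the pullback of a cospan is a
monomorphism. -/
theorem mono_of_isPullback_isPushout {A : Type*} [Category A] [Abelian A] {k x y q a : A}
    {p : k ⟶ x} {p' : k ⟶ y} {f : x ⟶ a} {g : y ⟶ a} {i : x ⟶ q} {j : y ⟶ q}
    (sq : IsPullback p p' f g) (sq' : IsPushout p p' i j) (m : q ⟶ a) (hi : i ≫ m = f)
    (hj : j ≫ m = g) : Mono m := by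
  have hepi : Epi (biprod.desc i j) := by
    refine ⟨fun u v h => ?_⟩
    apply sq'.hom_ext
    · simpa using congrArg (fun t => biprod.inl ≫ t) h
    · simpa using congrArg (fun t => biprod.inr ≫ t) h
  refine Preadditive.mono_of_cancel_zero _ fun {t} u hu => ?_
  obtain ⟨t', e, w, he, hw⟩ : ∃ (t' : A) (e : t' ⟶ t) (w : t' ⟶ x ⊞ y), Epi e ∧
      e ≫ u = w ≫ biprod.desc i j :=
    ⟨_, pullback.fst u (biprod.desc i j), pullback.snd u (biprod.desc i j), inferInstance,
      pullback.condition⟩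
  rw [← cancel_epi e, comp_zero, hw]
  have h0 : (w ≫ biprod.fst) ≫ f = (-(w ≫ biprod.snd)) ≫ g := by
    have h1 : w ≫ biprod.desc i j ≫ m = 0 := by
      rw [← Category.assoc, ← hw, Category.assoc, hu, comp_zero]
    rw [biprod.desc_eq, Preadditive.add_comp, Category.assoc, Category.assoc, hi, hj,
      Preadditive.comp_add] at h1
    rw [Preadditive.neg_comp, Category.assoc, Category.assoc]
    exact eq_neg_of_add_eq_zero_left h1
  have h2 := sq.lift_fst _ _ h0
  have h3 := sq.lift_snd _ _ h0
  rw [biprod.desc_eq, Preadditive.comp_add, ← Category.assoc, ← h2, Category.assoc, sq'.w,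
    ← Category.assoc, h3, Preadditive.neg_comp, Category.assoc, neg_add_cancel]

theorem isPushout_epi_comp {A : Type*} [Category A] {n' n a b q : A} (e : n' ⟶ n) [Epi e]
    {f : n ⟶ a} {g : n ⟶ b} {i : a ⟶ q} {j : b ⟶ q} (sq : IsPushout f g i j) :
    IsPushout (e ≫ f) (e ≫ g) i j := by
  have hc (s : PushoutCocone (e ≫ f) (e ≫ g)) : f ≫ s.inl = g ≫ s.inr := by
    rw [← cancel_epi e, ← Category.assoc, ← Category.assoc]; exact s.condition
  refine ⟨⟨by rw [Category.assoc, sq.w, Category.assoc]⟩, ⟨PushoutCocone.IsColimit.mk _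
    (fun s => sq.desc s.inl s.inr (hc s)) (fun s => sq.inl_desc _ _ _)
    (fun s => sq.inr_desc _ _ _) fun s m h h' => ?_⟩⟩
  apply sq.hom_ext <;> simp [h, h']

variable (P : PROP.{v})

theorem isPullback_op {a b c n : ℕ} {f : P.Hom n a} {g : P.Hom n b} {i : P.Hom a c}
    {j : P.Hom b c} (sq : IsPushout (P.ar f) (P.ar g) (P.ar i) (P.ar j)) :
    IsPullback (P.op.ar (a := c) (b := a) i) (P.op.ar (a := c) (b := b) j)
      (P.op.ar (a := a) (b := n) f) (P.op.ar (a := b) (b := n) g) :=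
  IsPullback.of_map P.opFunctor sq.w sq.op.flip

instance [h : P.IsAbelian] : P.HasSpans := by
  obtain ⟨_, φ, hφ⟩ := h
  have hφ' {a b c d : ℕ} (f : P.Hom a b) (g : P.Hom c d) :
      biprod.map (P.ar f) (P.ar g) ≫ (φ b d).symm.hom =
        (φ a c).symm.hom ≫ P.ar (P.tensor f g) := by
    rw [Iso.symm_hom, Iso.symm_hom, Iso.comp_inv_eq, Category.assoc, hφ, Iso.inv_hom_id_assoc]
  exact ⟨inferInstance, fun sq sq' => (isPullback_biprod_map sq sq').of_iso
    (φ _ _).symm (φ _ _).symm (φ _ _).symm (φ _ _).symm (hφ' _ _) (hφ' _ _) (hφ' _ _) (hφ' _ _)⟩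

instance [h : P.IsAbelian] : HasPushouts P.Ob := by
  obtain ⟨_, -⟩ := h
  infer_instance

instance [h : P.IsAbelian] : P.SpanClass (MorphismProperty.isomorphisms P.Ob) := by
  obtain ⟨_, φ, hφ⟩ := h
  refine ⟨fun f hf => hf, inferInstance, fun {a b c d} f g hf hg => ?_⟩
  have : IsIso (P.ar f) := hf
  have : IsIso (P.ar g) := hg
  have h1 : P.ar (P.tensor f g) =
      (φ a c).hom ≫ (biprod.mapIso (asIso (P.ar f)) (asIso (P.ar g))).hom ≫ (φ b d).inv := by
    rw [← Category.assoc, Iso.eq_comp_inv, hφ]; rfl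
  rw [h1]
  exact inferInstanceAs (IsIso (_ ≫ _ ≫ _))

instance [h : P.IsAbelian] : P.SpanClass (MorphismProperty.epimorphisms P.Ob) := by
  obtain ⟨_, φ, hφ⟩ := h
  refine ⟨fun f hf => inferInstanceAs (Epi f), inferInstance, fun {a b c d} f g hf hg => ?_⟩
  have : Epi (P.ar f) := hf
  have : Epi (P.ar g) := hg
  have h1 : P.ar (P.tensor f g) = (φ a c).hom ≫ biprod.map (P.ar f) (P.ar g) ≫ (φ b d).inv := by
    rw [← Category.assoc, Iso.eq_comp_inv, hφ]
  rw [h1]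
  exact inferInstanceAs (Epi (_ ≫ _ ≫ _))

variable [P.IsAbelian]

/-- The prop of spans: an arrow `a ⟶ b` is an isomorphism class of spans `a ⟵ n ⟶ b` in `P`. -/
noncomputable def Span : PROP.{v} := spanProp P (MorphismProperty.isomorphisms P.Ob)

/-- The prop of relations, for the epi-mono factorisation system: an arrow `a ⟶ b` is an
equivalence class of spans `a ⟵ n ⟶ b` in `P`, for the equivalence relation that identifies two
spans whenever there is an epimorphism between their apices that commutes with the legs. -/
noncomputable def Rel : PROP.{v} := spanProp P (MorphismProperty.epimorphisms P.Ob)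

/-- The prop of cospans: a cospan `a ⟶ n ⟵ b` in `P` is a span in the opposite prop, and a
pushout in `P` is a pullback in the opposite prop. -/
noncomputable def Cospan : PROP.{v} := Span P.op

/-- The prop of corelations, for the epi-mono factorisation system: an arrow `a ⟶ b` is an
equivalence class of cospans `a ⟶ n ⟵ b` in `P`, for the equivalence relation that identifies two
cospans whenever there is a monomorphism between their apices (an epimorphism of the opposite
prop) that commutes with the legs. -/
noncomputable def Corel : PROP.{v} := Rel P.op

variable {P}

/-- The isomorphism class of the span `a ⟵ n ⟶ b` with legs `f` and `g`. -/
def spanMk {a b n : ℕ} (f : P.Hom n a) (g : P.Hom n b) : P.Span.Hom a b :=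
  SpanHom.mk (MorphismProperty.isomorphisms P.Ob) f g

/-- The relation represented by the span `a ⟵ n ⟶ b` with legs `f` and `g`. -/
def relMk {a b n : ℕ} (f : P.Hom n a) (g : P.Hom n b) : P.Rel.Hom a b :=
  SpanHom.mk (MorphismProperty.epimorphisms P.Ob) f g

/-- The isomorphism class of the cospan `a ⟶ n ⟵ b` with legs `f` and `g`. -/
def cospanMk {a b n : ℕ} (f : P.Hom a n) (g : P.Hom b n) : P.Cospan.Hom a b :=
  spanMk (P := P.op) f g

/-- The corelation represented by the cospan `a ⟶ n ⟵ b` with legs `f` and `g`. -/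
def corelMk {a b n : ℕ} (f : P.Hom a n) (g : P.Hom b n) : P.Corel.Hom a b :=
  relMk (P := P.op) f g

variable (P)

/-- The morphism sending `f : a ⟶ b` to the span `a ⟵ a ⟶ b` with legs the identity and `f`. -/
noncomputable def homToSpan : P ⟶ P.Span := spanOfHom P _

/-- The morphism sending `g : b ⟶ a`, as an arrow `a ⟶ b` of the opposite prop, to the span
`a ⟵ b ⟶ b` with legs `g` and the identity. -/
noncomputable def opToSpan : P.op ⟶ P.Span := spanOfOp P _

/-- The morphism sending `f : a ⟶ b` to the cospan `a ⟶ b ⟵ b` with legs `f` and the identity. -/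
noncomputable def homToCospan : P ⟶ P.Cospan := opToSpan P.op

/-- The morphism sending `g : b ⟶ a`, as an arrow `a ⟶ b` of the opposite prop, to the cospan
`a ⟶ a ⟵ b` with legs the identity and `g`. -/
noncomputable def opToCospan : P.op ⟶ P.Cospan := homToSpan P.op

theorem app_homToSpan {a b : ℕ} (f : P.Hom a b) : app P.homToSpan f = spanMk (P.id a) f := rfl
theorem app_opToSpan {a b : ℕ} (g : P.Hom b a) :
    app P.opToSpan (a := a) (b := b) g = spanMk g (P.id b) := rfl
theorem app_homToCospan {a b : ℕ} (f : P.Hom a b) :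
    app P.homToCospan f = cospanMk f (P.id b) := rfl
theorem app_opToCospan {a b : ℕ} (g : P.Hom b a) :
    app P.opToCospan (a := a) (b := b) g = cospanMk (P.id a) g := rfl

variable {P} in
/-- An isomorphism class of spans determines a relation. -/
def spanToRelMap {a b : ℕ} (s : P.Span.Hom a b) : P.Rel.Hom a b :=
  Quot.lift (fun t : RawSpan P a b => relMk t.left t.right)
    (by
      rintro ⟨n, f, g⟩ ⟨m, h, k⟩ ⟨e, he, hf, hg⟩
      have he : IsIso (P.ar e) := he
      exact SpanHom.eq_of e (inferInstanceAs (Epi (P.ar e))) hf hg) s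

/-- The morphism sending the isomorphism class of a span to the relation that it represents. -/
noncomputable def spanToRel : P.Span ⟶ P.Rel where
  map := spanToRelMap
  map_id _ := rfl
  map_comp s t := by
    obtain ⟨n, f, g, rfl⟩ := SpanHom.ind s
    obtain ⟨m, h, k, rfl⟩ := SpanHom.ind t
    obtain ⟨l, p, q, sq⟩ := exists_isPullback g h
    exact (congrArg spanToRelMap (SpanHom.mk_comp_mk sq)).trans (SpanHom.mk_comp_mk sq).symm
  map_tensor s t := by
    obtain ⟨n, f, g, rfl⟩ := SpanHom.ind s
    obtain ⟨m, h, k, rfl⟩ := SpanHom.ind t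
    rfl
  map_symm _ _ := rfl

/-- The morphism `Γ` sending the isomorphism class of a cospan to the corelation that it
represents. -/
noncomputable def cospanToCorel : P.Cospan ⟶ P.Corel := spanToRel P.op

theorem app_spanToRel {a b n : ℕ} (f : P.Hom n a) (g : P.Hom n b) :
    app P.spanToRel (spanMk f g) = relMk f g := rfl
theorem app_cospanToCorel {a b n : ℕ} (f : P.Hom a n) (g : P.Hom b n) :
    app P.cospanToCorel (cospanMk f g) = corelMk f g := rfl

variable {P}

theorem corelMk_eq {a b n m : ℕ} {f : P.Hom a n} {g : P.Hom b n} {f' : P.Hom a m} {g' : P.Hom b m}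
    (e : P.Hom n m) (he : Mono (P.ar e)) (hf : P.comp f e = f') (hg : P.comp g e = g') :
    corelMk f g = corelMk f' g' := by
  refine (SpanHom.eq_of (P := P.op) (W := MorphismProperty.epimorphisms P.op.Ob) e ?_ hf hg).symm
  refine ⟨fun {x} u w h => ?_⟩
  let u' : P.ob x ⟶ P.ob n := u
  let w' : P.ob x ⟶ P.ob n := w
  change u' ≫ P.ar e = w' ≫ P.ar e at h
  exact (cancel_mono (P.ar e)).1 h

theorem exists_isPushout {a b n : ℕ} (f : P.Hom n a) (g : P.Hom n b) :
    ∃ (m : ℕ) (i : P.Hom a m) (j : P.Hom b m),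
      IsPushout (P.ar f) (P.ar g) (P.ar i) (P.ar j) :=
  ⟨_, _, _, IsPushout.of_hasPushout (P.ar f) (P.ar g)⟩

/-- The corelation represented by the pushout of a span. -/
noncomputable def pushoutCorel {a b : ℕ} (s : RawSpan P a b) : P.Corel.Hom a b :=
  corelMk (n := (pushout (P.ar s.left) (P.ar s.right) : P.Ob))
    (pushout.inl (P.ar s.left) (P.ar s.right)) (pushout.inr (P.ar s.left) (P.ar s.right))

theorem pushoutCorel_eq {a b n m : ℕ} {f : P.Hom n a} {g : P.Hom n b} {i : P.Hom a m}
    {j : P.Hom b m} (sq : IsPushout (P.ar f) (P.ar g) (P.ar i) (P.ar j)) :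
    pushoutCorel ⟨n, f, g⟩ = corelMk i j :=
  (corelMk_eq sq.isoPushout.hom (inferInstanceAs (Mono sq.isoPushout.hom))
    sq.inl_isoPushout_hom sq.inr_isoPushout_hom).symm

/-- The corelation represented by the pushout of an isomorphism class of spans. -/
noncomputable def spanToCorelMap {a b : ℕ} (s : P.Span.Hom a b) : P.Corel.Hom a b :=
  Quot.lift pushoutCorel
    (by
      rintro ⟨n, f, g⟩ ⟨m, h, k⟩ ⟨e, he, hf, hg⟩
      dsimp only at e he hf hg
      subst hf hg
      have he : IsIso (P.ar e) := he
      obtain ⟨q, i, j, sq⟩ := exists_isPushout h k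
      have sq' : IsPushout (P.ar (P.comp e h)) (P.ar (P.comp e k)) (P.ar i) (P.ar j) :=
        isPushout_epi_comp (P.ar e) sq
      rw [pushoutCorel_eq sq, pushoutCorel_eq sq']) s

theorem spanToCorelMap_mk {a b n m : ℕ} {f : P.Hom n a} {g : P.Hom n b} {i : P.Hom a m}
    {j : P.Hom b m} (sq : IsPushout (P.ar f) (P.ar g) (P.ar i) (P.ar j)) :
    spanToCorelMap (spanMk f g) = corelMk i j :=
  pushoutCorel_eq sq

/-- The inclusion of `P` into corelations. -/
noncomputable def homToCorel (P : PROP.{v}) [P.IsAbelian] : P ⟶ P.Corel :=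
  P.homToCospan ≫ P.cospanToCorel

/-- The inclusion of the opposite of `P` into corelations. -/
noncomputable def opToCorel (P : PROP.{v}) [P.IsAbelian] : P.op ⟶ P.Corel :=
  P.opToCospan ≫ P.cospanToCorel

theorem spanToCorelMap_eq {a b n : ℕ} (f : P.Hom n a) (g : P.Hom n b) :
    spanToCorelMap (spanMk f g) =
      P.Corel.comp (app P.opToCorel (a := a) (b := n) f) (app P.homToCorel g) := by
  obtain ⟨m, i, j, sq⟩ := exists_isPushout f g
  rw [spanToCorelMap_mk sq]
  exact (spanOfHom_comp_spanOfOp (P := P.op) (W := MorphismProperty.epimorphisms P.op.Ob)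
    (isPullback_op P sq)).symm

theorem homToCorel_comp_opToCorel {a b c : ℕ} (f : P.Hom a c) (g : P.Hom b c) :
    P.Corel.comp (app P.homToCorel f) (app P.opToCorel (a := c) (b := b) g) = corelMk f g :=
  spanOfOp_comp_spanOfHom (P := P.op) (W := MorphismProperty.epimorphisms P.op.Ob) f g

theorem spanToCorelMap_isPullback {a b c n : ℕ} {p : P.Hom n a} {q : P.Hom n b} {f : P.Hom a c}
    {g : P.Hom b c} (sq : IsPullback (P.ar p) (P.ar q) (P.ar f) (P.ar g)) :
    spanToCorelMap (spanMk p q) = corelMk f g := by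
  obtain ⟨m, i, j, sq'⟩ := exists_isPushout p q
  rw [spanToCorelMap_mk sq']
  obtain ⟨_, -⟩ := IsAbelian.exists_biproduct (P := P)
  exact corelMk_eq (sq'.desc _ _ sq.w)
    (mono_of_isPullback_isPushout sq sq' _ (sq'.inl_desc _ _ sq.w) (sq'.inr_desc _ _ sq.w))
    (sq'.inl_desc _ _ sq.w) (sq'.inr_desc _ _ sq.w)

variable (P) in
/-- The morphism `Π` sending the isomorphism class of a span to the corelation represented by its
pushout. -/
noncomputable def spanToCorel : P.Span ⟶ P.Corel where
  map := spanToCorelMap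
  map_id a := spanToCorelMap_mk (IsPushout.id_horiz (𝟙 (P.ob a)))
  map_comp {a b c} s t := by
    obtain ⟨n, f, g, rfl⟩ := SpanHom.ind s
    obtain ⟨m, h, k, rfl⟩ := SpanHom.ind t
    obtain ⟨l, p, q, sq⟩ := exists_isPullback g h
    have h1 : P.Span.comp (spanMk f g) (spanMk h k) = spanMk (P.comp p f) (P.comp q k) :=
      SpanHom.mk_comp_mk sq
    have h2 : app P.opToCorel (a := a) (b := l) (P.comp p f) =
        P.Corel.comp (app P.opToCorel (a := a) (b := n) f)
          (app P.opToCorel (a := n) (b := l) p) := app_comp P.opToCorel _ _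
    have h3 := (spanToCorelMap_eq p q).symm.trans
      ((spanToCorelMap_isPullback sq).trans (homToCorel_comp_opToCorel g h).symm)
    change spanToCorelMap (P.Span.comp (spanMk f g) (spanMk h k)) =
      P.Corel.comp (spanToCorelMap (spanMk f g)) (spanToCorelMap (spanMk h k))
    rw [h1, spanToCorelMap_eq, spanToCorelMap_eq, spanToCorelMap_eq, h2, app_comp, P.Corel.assoc,
      P.Corel.assoc, ← P.Corel.assoc (app P.opToCorel p), h3, P.Corel.assoc]
  map_tensor {a b c d} s t := by
    obtain ⟨n, f, g, rfl⟩ := SpanHom.ind s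
    obtain ⟨m, h, k, rfl⟩ := SpanHom.ind t
    have h1 : app P.opToCorel (a := a + c) (b := n + m) (P.tensor f h) =
        P.Corel.tensor (app P.opToCorel (a := a) (b := n) f)
          (app P.opToCorel (a := c) (b := m) h) := app_tensor P.opToCorel _ _
    change spanToCorelMap (spanMk (P.tensor f h) (P.tensor g k)) =
      P.Corel.tensor (spanToCorelMap (spanMk f g)) (spanToCorelMap (spanMk h k))
    rw [spanToCorelMap_eq, spanToCorelMap_eq, spanToCorelMap_eq, h1, app_tensor,
      P.Corel.tensor_comp]
  map_symm a b := by
    change spanToCorelMap (spanMk (P.id _) (P.symm a b)) = _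
    have h1 : app P.opToCorel (a := a + b) (b := a + b) (P.id _) = P.Corel.id _ :=
      app_id P.opToCorel _
    rw [spanToCorelMap_eq, h1, app_symm, P.Corel.id_comp]

variable (P)

/-- The morphism sending the isomorphism class of a cospan to the relation represented by its
pullback, that is, the morphism `spanToCorel` of the opposite prop. -/
noncomputable def cospanToRel : P.Cospan ⟶ P.Rel := spanToCorel P.op

variable {P}

theorem app_spanToCorel {a b n m : ℕ} {f : P.Hom n a} {g : P.Hom n b} {i : P.Hom a m}
    {j : P.Hom b m} (sq : IsPushout (P.ar f) (P.ar g) (P.ar i) (P.ar j)) :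
    app P.spanToCorel (spanMk f g) = corelMk i j :=
  spanToCorelMap_mk sq

theorem isPushout_op {a b c n : ℕ} {p : P.Hom n a} {q : P.Hom n b} {f : P.Hom a c}
    {g : P.Hom b c} (sq : IsPullback (P.ar p) (P.ar q) (P.ar f) (P.ar g)) :
    IsPushout (P.op.ar (a := c) (b := a) f) (P.op.ar (a := c) (b := b) g)
      (P.op.ar (a := a) (b := n) p) (P.op.ar (a := b) (b := n) q) :=
  IsPushout.of_map P.opFunctor sq.w sq.op.flip

theorem app_cospanToRel {a b c n : ℕ} {p : P.Hom n a} {q : P.Hom n b} {f : P.Hom a c}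
    {g : P.Hom b c} (sq : IsPullback (P.ar p) (P.ar q) (P.ar f) (P.ar g)) :
    app P.cospanToRel (cospanMk f g) = relMk p q :=
  spanToCorelMap_mk (P := P.op) (isPushout_op sq)

end Abelian

end PROP

namespace PROP

/-! ### The pushout square of spans, cospans and corelations -/

section CorelPushout

/-! Write `f` also for its image in spans or cospans, and `f°` for the image of `f` taken in the
opposite prop. A span with legs `f`, `g` is `f° ; g` and a cospan with legs `f`, `g` is `f ; g°`. A
morphism out of either prop is therefore determined by its values on the arrows of `P` and of
`P.op`.

Let `α` on spans and `β` on cospans agree on these generators. Corelations are cospans modulo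
monomorphisms between apices, so `β` descends along `Γ` as soon as `β` does not see a monomorphism
`e` composed with both legs: `f ; e ; e° ; g°` and `f ; g°` must have the same image. In spans `e ;
e°` is the identity, because the kernel pair of a monomorphism is trivial. Applying `α` carries this
equation to the target, where `α` and `β` coincide on `e` and `e°` (`app_cospanMk_comp_mono`). The
induced morphism restricts to `α` along `Π`: if the span `f`, `g` has pushout `i`, `j`, then `i ;
j°` equals `f° ; g` in cospans, and `β` and `α` agree on each factor (`spanToCorel_corelDesc`). It
is unique because `Γ` is surjective on arrows.

The comparison with relations is formal. Cospans and corelations of `P` are by definition spans and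
relations of `P.op`, which is again abelian, and `P.op.op` is `P` definitionally. The dual of the
square commutes, so the universal property gives a morphism from corelations to relations; for
`P.op` it gives a morphism the other way. The two are inverse, since composites can be tested on the
epimorphism `Γ` and on its dual. -/

theorem epi_of_app_surjective {P Q : PROP.{v}} (F : P ⟶ Q)
    (h : ∀ {a b : ℕ} (s : Q.Hom a b), ∃ t : P.Hom a b, app F t = s) : Epi F := by
  refine ⟨fun {X} G H e => hom_ext fun {a b} s => ?_⟩
  obtain ⟨t, rfl⟩ := h s
  exact congrArg (fun K => app K t) e

theorem mono_of_epi_op {P : PROP.{v}} {a b : ℕ} (e : P.op.Hom a b) (he : Epi (P.op.ar e)) :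
    Mono (P.ar (a := b) (b := a) e) :=
  ⟨fun {x} u w h => he.left_cancellation (Z := P.op.ob x) u w h⟩

/-! ### Generators of spans and cospans, and commutativity of the square. -/

variable {P : PROP.{v}} [P.IsAbelian]

/-- This factorisation and its dual `cospanMk_eq_comp` reduce a computation with `α` or `β` to the
generators, where the two agree. -/
theorem spanMk_eq_comp {a b n : ℕ} (f : P.Hom n a) (g : P.Hom n b) :
    spanMk f g = P.Span.comp (app P.opToSpan (a := a) (b := n) f) (app P.homToSpan g) :=
  (spanOfOp_comp_spanOfHom P (MorphismProperty.isomorphisms P.Ob) f g).symm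

theorem cospanMk_eq_comp {a b n : ℕ} (f : P.Hom a n) (g : P.Hom b n) :
    cospanMk f g = P.Cospan.comp (app P.homToCospan f) (app P.opToCospan (a := n) (b := b) g) :=
  spanMk_eq_comp (P := P.op) f g

/-- A backward arrow followed by a forward one is composed by pushout, which is a pullback in
`P.op`. This is how the cospan given by the pushout of a span is read back in terms of the legs of
the span. -/
theorem opToCospan_comp_homToCospan {a b n m : ℕ} {f : P.Hom n a} {g : P.Hom n b}
    {i : P.Hom a m} {j : P.Hom b m}
    (sq : IsPushout (P.ar f) (P.ar g) (P.ar i) (P.ar j)) :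
    P.Cospan.comp (app P.opToCospan (a := a) (b := n) f) (app P.homToCospan g) = cospanMk i j :=
  spanOfHom_comp_spanOfOp (P := P.op) (W := MorphismProperty.isomorphisms P.op.Ob)
    (isPullback_op P sq)

/-- In spans, a monomorphism followed by its converse is the identity. -/
theorem homToSpan_comp_opToSpan_of_mono {a b : ℕ} (m : P.Hom a b) (hm : Mono (P.ar m)) :
    P.Span.comp (app P.homToSpan m) (app P.opToSpan (a := b) (b := a) m) = P.Span.id a :=
  spanOfHom_comp_spanOfOp (P := P) (W := MorphismProperty.isomorphisms P.Ob)
    -- The pullback of a monomorphism along itself is the pair of identities, and the span with two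
    -- identity legs is by definition the identity.
    (p := P.id a) (q := P.id a) (IsKernelPair.id_of_mono (P.ar m))

instance : Epi P.cospanToCorel := epi_of_app_surjective _ fun s => by
  obtain ⟨n, f, g, rfl⟩ := SpanHom.ind s
  exact ⟨cospanMk (P := P) f g, rfl⟩

/-- An identity and `f` have pushout `f` and an identity, so `Π` turns the span of a generator into
the cospan of the same generator. This equality and the next are the commutativity of the square on
the two summands. -/
theorem homToSpan_comp_spanToCorel :
    P.homToSpan ≫ P.spanToCorel = P.homToCospan ≫ P.cospanToCorel :=
  hom_ext fun {a b} f => app_spanToCorel (P := P) (a := a) (b := b)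
    (f := P.id a) (g := f) (i := f) (j := P.id b) (IsPushout.id_horiz (P.ar f))

theorem opToSpan_comp_spanToCorel :
    P.opToSpan ≫ P.spanToCorel = P.opToCospan ≫ P.cospanToCorel :=
  hom_ext fun {a b} f => app_spanToCorel (P := P) (a := a) (b := b)
    (f := f) (g := P.id b) (i := P.id a) (j := f) (IsPushout.id_vert (P.ar (a := b) (b := a) f))

/-- Passing to `P.op` exchanges forward and backward arrows, spans and cospans, relations and
corelations. Hence each half of the dual square is the opposite half of the original one. -/
theorem homToCospan_comp_cospanToRel :
    P.homToCospan ≫ P.cospanToRel = P.homToSpan ≫ P.spanToRel :=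
  opToSpan_comp_spanToCorel (P := P.op)

theorem opToCospan_comp_cospanToRel :
    P.opToCospan ≫ P.cospanToRel = P.opToSpan ≫ P.spanToRel :=
  homToSpan_comp_spanToCorel (P := P.op)

/-! ### The morphism induced on corelations. -/

section Desc

variable {X : PROP.{v}} {α : P.Span ⟶ X} {β : P.Cospan ⟶ X}

/-- If `α` and `β` agree on the arrows of `P` and on those of its opposite, then `β` does not
distinguish two cospans that are related by a monomorphism between their apices. -/
theorem app_cospanMk_comp_mono (hl : P.homToSpan ≫ α = P.homToCospan ≫ β)
    (hr : P.opToSpan ≫ α = P.opToCospan ≫ β) {a b n m : ℕ} (f : P.Hom a n) (g : P.Hom b n)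
    (e : P.Hom n m) (he : Mono (P.ar e)) :
    app β (cospanMk (P.comp f e) (P.comp g e)) = app β (cospanMk f g) := by
  have h1 : app β (app P.homToCospan e) = app α (app P.homToSpan e) :=
    congrArg (fun F => app F e) hl.symm
  have h2 : app β (app P.opToCospan (a := m) (b := n) e) =
      app α (app P.opToSpan (a := m) (b := n) e) :=
    congrArg (fun F : P.op ⟶ X => app F (a := m) (b := n) e) hr.symm
  -- Reversal is contravariant: the converse of `g` followed by `e` is `e°` followed by `g°`, which
  -- places `e°` next to `e`.
  have h3 : app P.opToCospan (a := m) (b := b) (P.comp g e) =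
      P.Cospan.comp (app P.opToCospan (a := m) (b := n) e)
        (app P.opToCospan (a := n) (b := b) g) := app_comp P.opToCospan _ _
  -- The equation comes from spans, through `α`. In cospans the composite `e ; e°` is the cospan
  -- with both legs `e`, which is the identity only when `e` is invertible.
  have h4 : X.comp (app β (app P.homToCospan e)) (app β (app P.opToCospan (a := m) (b := n) e)) =
      X.id n := by
    rw [h1, h2, ← app_comp, homToSpan_comp_opToSpan_of_mono e he, app_id]
  rw [cospanMk_eq_comp, cospanMk_eq_comp, h3, app_comp, app_comp, app_comp, app_comp, app_comp,
    X.assoc, ← X.assoc (app β (app P.homToCospan e)), h4, X.id_comp]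

/-- The morphism out of corelations induced by compatible morphisms out of spans and cospans. -/
noncomputable def corelDesc (hl : P.homToSpan ≫ α = P.homToCospan ≫ β)
    (hr : P.opToSpan ≫ α = P.opToCospan ≫ β) : P.Corel ⟶ X where
  map {a b} s := Quot.lift (fun t : RawSpan P.op a b => app β (cospanMk (P := P) t.left t.right))
    (by
      rintro ⟨n, f, g⟩ ⟨m, h, k⟩ ⟨e, he, hf, hg⟩
      dsimp only at e he hf hg
      subst hf hg
      -- As an arrow of `P`, `e` runs from `m` to `n`, so the cospan of apex `n` is the one whose
      -- legs are `h` and `k` composed with `e`.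
      exact app_cospanMk_comp_mono hl hr (n := m) (m := n) h k e (mono_of_epi_op e he)) s
  map_id a := app_id β a
  map_comp s t := by
    obtain ⟨s, rfl⟩ := Quot.exists_rep s
    obtain ⟨t, rfl⟩ := Quot.exists_rep t
    -- Cospans and corelations compose through the same chosen pushout of representatives, so
    -- functoriality of `β` is already the required equation.
    exact app_comp β (cospanMk (P := P) s.left s.right) (cospanMk (P := P) t.left t.right)
  map_tensor s t := by
    obtain ⟨s, rfl⟩ := Quot.exists_rep s
    obtain ⟨t, rfl⟩ := Quot.exists_rep t
    exact app_tensor β (cospanMk (P := P) s.left s.right) (cospanMk (P := P) t.left t.right)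
  map_symm a b := app_symm β a b

variable (hl : P.homToSpan ≫ α = P.homToCospan ≫ β) (hr : P.opToSpan ≫ α = P.opToCospan ≫ β)

theorem cospanToCorel_corelDesc : P.cospanToCorel ≫ corelDesc hl hr = β :=
  hom_ext fun {a b} s => by
    obtain ⟨n, f, g, rfl⟩ := SpanHom.ind s
    rfl

theorem spanToCorel_corelDesc : P.spanToCorel ≫ corelDesc hl hr = α :=
  hom_ext fun {a b} s => by
    obtain ⟨n, f, g, rfl⟩ := SpanHom.ind s
    obtain ⟨m, i, j, sq⟩ := exists_isPushout f g
    have h1 : app (corelDesc hl hr) (app P.spanToCorel (spanMk f g)) = app β (cospanMk i j) :=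
      congrArg (app (corelDesc hl hr)) (app_spanToCorel sq)
    have h2 : app β (app P.homToCospan g) = app α (app P.homToSpan g) :=
      congrArg (fun F => app F g) hl.symm
    have h3 : app β (app P.opToCospan (a := a) (b := n) f) =
        app α (app P.opToSpan (a := a) (b := n) f) :=
      congrArg (fun F : P.op ⟶ X => app F (a := a) (b := n) f) hr.symm
    -- Both sides become the image of `f°` followed by the image of `g`: on the left by the pushout
    -- square, on the right by the factorisation of a span.
    have h4 : app β (cospanMk i j) = app α (spanMk f g) := by
      rw [← opToCospan_comp_homToCospan sq, spanMk_eq_comp, app_comp, app_comp, h2, h3]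
    exact h1.trans h4

end Desc

/-! ### The universal property of the square. -/

/-- Turns the condition of a cocone under the coproduct of `P` and `P.op` into the two compatibility
hypotheses of `corelDesc`. -/
theorem comp_eq_of_coprod_desc_comp_eq {A : Type*} [Category A] [HasBinaryCoproducts A]
    {p q x y z : A} {f : p ⟶ x} {g : q ⟶ x} {f' : p ⟶ y} {g' : q ⟶ y} {u : x ⟶ z} {w : y ⟶ z}
    (h : coprod.desc f g ≫ u = coprod.desc f' g' ≫ w) : f ≫ u = f' ≫ w ∧ g ≫ u = g' ≫ w :=
  ⟨by simpa only [coprod.inl_desc_assoc] using congrArg (fun t => coprod.inl ≫ t) h,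
    by simpa only [coprod.inr_desc_assoc] using congrArg (fun t => coprod.inr ≫ t) h⟩

theorem isPushout_spanToCorel_cospanToCorel :
    IsPushout (coprod.desc P.homToSpan P.opToSpan : P ⨿ P.op ⟶ P.Span)
      (coprod.desc P.homToCospan P.opToCospan : P ⨿ P.op ⟶ P.Cospan)
      P.spanToCorel P.cospanToCorel := by
  refine ⟨⟨?_⟩, ⟨PushoutCocone.IsColimit.mk _ (fun s =>
      corelDesc (comp_eq_of_coprod_desc_comp_eq s.condition).1
        (comp_eq_of_coprod_desc_comp_eq s.condition).2)
    (fun s => spanToCorel_corelDesc _ _) (fun s => cospanToCorel_corelDesc _ _)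
    fun s m _ h => ?_⟩⟩
  · rw [coprod.desc_comp, coprod.desc_comp, homToSpan_comp_spanToCorel, opToSpan_comp_spanToCorel]
  · rw [← cancel_epi P.cospanToCorel, h, cospanToCorel_corelDesc]

/-! ### The isomorphism between corelations and relations. -/

variable (P)

/-- The morphism sending a corelation to the relation represented by the pullback of a
representing cospan. -/
noncomputable def corelToRel : P.Corel ⟶ P.Rel :=
  -- The universal property is applied with target `P.Rel`, `α` being `P.spanToRel` and `β` being
  -- `P.cospanToRel`.
  corelDesc homToCospan_comp_cospanToRel.symm opToCospan_comp_cospanToRel.symm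

theorem spanToCorel_corelToRel : P.spanToCorel ≫ P.corelToRel = P.spanToRel :=
  spanToCorel_corelDesc _ _

theorem cospanToCorel_corelToRel : P.cospanToCorel ≫ P.corelToRel = P.cospanToRel :=
  cospanToCorel_corelDesc _ _

/-- The morphism sending a relation to the corelation represented by the pushout of a representing
span. -/
noncomputable def relToCorel : P.Rel ⟶ P.Corel := corelToRel P.op

theorem cospanToRel_relToCorel : P.cospanToRel ≫ P.relToCorel = P.cospanToCorel :=
  spanToCorel_corelToRel P.op

/-- After precomposition with the epimorphism `Γ`, the composite passes through `P.cospanToRel` and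
comes back to `Γ`. -/
theorem corelToRel_relToCorel : P.corelToRel ≫ P.relToCorel = 𝟙 P.Corel := by
  rw [← cancel_epi P.cospanToCorel, ← Category.assoc, cospanToCorel_corelToRel,
    cospanToRel_relToCorel, Category.comp_id]

/-- Corelations and relations in an abelian prop are isomorphic props. -/
noncomputable def corelIsoRel : P.Corel ≅ P.Rel where
  hom := P.corelToRel
  inv := P.relToCorel
  hom_inv_id := P.corelToRel_relToCorel
  -- For `P.op` the two morphisms exchange roles, so the other composite is the same lemma.
  inv_hom_id := corelToRel_relToCorel P.op

end CorelPushout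

end PROP

theorem mainTheorem7 (C : PROP.{v}) [C.IsAbelian] :
    IsPushout (coprod.desc C.homToSpan C.opToSpan : C ⨿ C.op ⟶ C.Span)
      (coprod.desc C.homToCospan C.opToCospan : C ⨿ C.op ⟶ C.Cospan)
      C.spanToCorel C.cospanToCorel ∧
    ∃ e : C.Corel ≅ C.Rel,
      C.spanToCorel ≫ e.hom = C.spanToRel ∧ C.cospanToCorel ≫ e.hom = C.cospanToRel :=
  ⟨PROP.isPushout_spanToCorel_cospanToCorel, C.corelIsoRel, C.spanToCorel_corelToRel,
    C.cospanToCorel_corelToRel⟩
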